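/- For an integer $N\ge 1$ and $\beta\in[0,1]$ let $$V_{N-1}(\beta)=\mathrm{vol}_{N-1}\Big\{y\in[0,1]^{N-1}:\ \beta N-1\le \sum_{j=1}^{N-1}y_j\le \beta N\Big\}$$ be the volume of a slab of the $(N-1)$-dimensional unit cube. For $z\in(0,1)\cup(1,\infty)$ put $$\beta(z)=\frac1{1-z}+\frac1{\ln z},\qquad F(z)=\frac{z^{z/(1-z)}(z-1)\,e}{\ln z},$$ and put $\beta(1)=\tfrac12$, $F(1)=1$. (1) The functions $\beta(z)$ and $F(z)$ are continuous on $(0,\infty)$. The map $z\mapsto\beta(z)$ is strictly decreasing and maps $(0,\infty)$ bijectively onto $(0,1)$, with $\beta(z)\to1$ as $z\to0^+$ and $\beta(z)\to0$ as $z\to\infty$. Moreover $F(z)\to0$ as $z\to0^+$ and as $z\to\infty$. Consequently the relation $f(\beta(z))=F(z)$ for $z>0$, together with $f(0)=f(1)=0$, defines a single-valued continuous function $f$ on $[0,1]$, and $f(\tfrac12)=1$. (2) There is a positive function $A$ on $[0,1]$, continuously differentiable on $(0,1)$ (in particular bounded on compact subsets of $(0,1)$), with $A(\tfrac12)=\sqrt{6/\pi}$,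 such that for every fixed $\beta\in[0,1]$ $$V_{N-1}(\beta)=\frac{A(\beta)}{\sqrt N}\,f(\beta)^N\,(1+o(1)),\qquad N\to\infty.$$ (3) Conversely, if $A',f':[0,1]\to\mathbb R$ are functions with $A'>0$ and $V_{N-1}(\beta)=A'(\beta)N^{-1/2}f'(\beta)^N(1+o(1))$ as $N\to\infty$ for every $\beta\in[0,1]$, then $f'=f$ on $[0,1]$ and $A'=A$ on $(0,1)$; in particular $A'(\tfrac12)=\sqrt{6/\pi}$. -/

import Mathlib

open Filter Topology MeasureTheory Set Asymptotics

noncomputable section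

/-- The slab of the `(N - 1)`-dimensional unit cube between two parallel hyperplanes orthogonal
to the main diagonal: all `y ∈ [0,1]^(N-1)` with `β N - 1 ≤ ∑ y_j ≤ β N`.
It is meant for `N ≥ 1`. -/
def slab (N : ℕ) (β : ℝ) : Set (Fin (N - 1) → ℝ) :=
  {y | (∀ j, 0 ≤ y j ∧ y j ≤ 1) ∧ β * N - 1 ≤ ∑ j, y j ∧ ∑ j, y j ≤ β * N}

/-- The `(N - 1)`-dimensional Lebesgue measure `V_{N-1}(β)` of the slab. -/
def slabVolume (N : ℕ) (β : ℝ) : ℝ := (volume (slab N β)).toReal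

/-- The parameter map `z ↦ β(z)` on `(0, ∞)`, with the value `1/2` filled in at `z = 1`. -/
def betaParam (z : ℝ) : ℝ :=
  if z = 1 then 1 / 2 else 1 / (1 - z) + 1 / Real.log z

/-- The parametric expression for `f`, as a function of `z ∈ (0, ∞)`, with the value `1` filled
in at `z = 1`. -/
def fParam (z : ℝ) : ℝ :=
  if z = 1 then 1 else z ^ (z / (1 - z)) * (z - 1) * Real.exp 1 / Real.log z

/-- `V_{N-1}(β) = A(β) N^(-1/2) f(β)^N (1 + o(1))` as `N → ∞`, for every fixed `β ∈ [0,1]`.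
Here `u ~[l] v` says `u - v = o(v)`, that is, `u = v (1 + o(1))`. -/
def HasSlabAsymptotics (A f : ℝ → ℝ) : Prop :=
  ∀ β ∈ Icc (0 : ℝ) 1,
    (fun N : ℕ => slabVolume N β) ~[atTop] fun N : ℕ => A β / √(N : ℝ) * f β ^ N

end

/-! The slab volume is the density at `β N` of a sum of `N` independent uniform variables on
`[0,1]`: given `N - 1` of them, the last must be `β N - ∑ y_j`, and this has to lie in `[0,1]`. The
asymptotics are therefore a local limit theorem at a point which, for `β ≠ 1/2`, lies at distance of
order `N` from the mean `N/2`.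

Exponential tilting moves the mean there. Let `K` be the cumulant generating function and choose `t`
with `K'(t) = β`. The density at `β N` is `exp (N (K(t) - t K'(t)))` times the density, at its own
mean, of a sum of `N` tilted variables, and the latter is `(2π N K''(t))^(-1/2) (1 + o(1))`. Hence
`f = exp (K - t K')` and `A = (2π K'')^(-1/2)`; the substitution `z = exp (-t)` gives the stated
formulas (`betaParam_eq`, `fParam_eq`). Monotonicity of `β(z)` is positivity of the variance `K''`,
and `K''(0) = 1/12` gives `A(1/2)`.

The local limit is obtained by Fourier inversion (`exp_mul_slabVolume`). The integrand converges
pointwise by the central limit theorem, and the bound `‖φ(s)‖² (1 + c s²) ≤ 1` on characteristic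
functions supplies both integrability and domination (`tendsto_integral_charFun_pow`). Uniqueness
holds because a geometric sequence with a nonzero limit has ratio `1`. -/

open ProbabilityTheory

/-! ### The uniform distribution on `[0,1]` and its exponential tilts -/

/-- The uniform distribution on the unit interval. -/
noncomputable abbrev unitUniform : Measure ℝ := volume.restrict (Icc 0 1)

/-- The cumulant generating function of the uniform distribution on `[0,1]`. -/
noncomputable abbrev uniformCgf (t : ℝ) : ℝ := cgf id unitUniform t

/-- The uniform distribution tilted by `exp (t x)`. -/
noncomputable abbrev tiltedUniform (t : ℝ) : Measure ℝ := unitUniform.tilted (t * id ·)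

/-- The mean of the tilted uniform distribution. -/
noncomputable def tiltedMean : ℝ → ℝ := deriv uniformCgf

/-- The variance of the tilted uniform distribution. -/
noncomputable def tiltedVar : ℝ → ℝ := deriv tiltedMean

instance : IsProbabilityMeasure unitUniform := ⟨by simp⟩

lemma integrable_unitUniform_of_continuous {E : Type*} [NormedAddCommGroup E] {f : ℝ → E}
    (hf : Continuous f) : Integrable f unitUniform :=
  hf.continuousOn.integrableOn_compact isCompact_Icc

lemma integrable_exp_mul_unitUniform (t : ℝ) :
    Integrable (fun x ↦ Real.exp (t * id x)) unitUniform :=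
  integrable_unitUniform_of_continuous (by simp only [id]; fun_prop)

lemma mem_interior_integrableExpSet_unitUniform (t : ℝ) :
    t ∈ interior (integrableExpSet id unitUniform) := by
  have : integrableExpSet id unitUniform = univ :=
    eq_univ_of_forall integrable_exp_mul_unitUniform
  simp [this]

instance (t : ℝ) : IsProbabilityMeasure (tiltedUniform t) :=
  isProbabilityMeasure_tilted (integrable_exp_mul_unitUniform t)

lemma analyticAt_uniformCgf (t : ℝ) : AnalyticAt ℝ uniformCgf t :=
  analyticAt_cgf (mem_interior_integrableExpSet_unitUniform t)

lemma analyticAt_tiltedMean (t : ℝ) : AnalyticAt ℝ tiltedMean t := (analyticAt_uniformCgf t).deriv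

lemma analyticAt_tiltedVar (t : ℝ) : AnalyticAt ℝ tiltedVar t := (analyticAt_tiltedMean t).deriv

lemma continuous_uniformCgf : Continuous uniformCgf :=
  continuous_iff_continuousAt.2 fun t ↦ (analyticAt_uniformCgf t).continuousAt

lemma continuous_tiltedMean : Continuous tiltedMean :=
  continuous_iff_continuousAt.2 fun t ↦ (analyticAt_tiltedMean t).continuousAt

lemma hasStrictDerivAt_tiltedMean (t : ℝ) : HasStrictDerivAt tiltedMean (tiltedVar t) t :=
  (analyticAt_tiltedMean t).hasStrictDerivAt

lemma integral_tiltedUniform (t : ℝ) : ∫ x, x ∂(tiltedUniform t) = tiltedMean t :=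
  integral_tilted_mul_self (mem_interior_integrableExpSet_unitUniform t)

lemma tiltedVar_eq_iteratedDeriv (t : ℝ) : tiltedVar t = iteratedDeriv 2 uniformCgf t := by
  rw [iteratedDeriv_succ, iteratedDeriv_one]; rfl

lemma variance_tiltedUniform (t : ℝ) : Var[id; tiltedUniform t] = tiltedVar t := by
  rw [tiltedVar_eq_iteratedDeriv]
  exact variance_tilted_mul (mem_interior_integrableExpSet_unitUniform t)

lemma memLp_id_tiltedUniform (t : ℝ) : MemLp id 2 (tiltedUniform t) :=
  memLp_tilted_mul (mem_interior_integrableExpSet_unitUniform t) 2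

/-- Zero variance would make the identity almost surely constant. Lebesgue measure on `[0,1]` is
absolutely continuous with respect to its tilt, so this would also hold for Lebesgue measure, which
has no atoms. -/
lemma tiltedVar_pos (t : ℝ) : 0 < tiltedVar t := by
  rw [← variance_tiltedUniform]
  refine (variance_nonneg _ _).lt_of_ne' fun h ↦ ?_
  have h1 := ae_eq_integral_of_variance_eq_zero (memLp_id_tiltedUniform t) h
  have h2 : ∀ᵐ x ∂unitUniform, x = ∫ y, id y ∂(tiltedUniform t) :=
    (absolutelyContinuous_tilted (integrable_exp_mul_unitUniform t)).ae_le h1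
  have h3 : ∀ᵐ x ∂unitUniform, x ≠ ∫ y, id y ∂(tiltedUniform t) :=
    measure_mono_null (fun x hx ↦ by simpa using hx) (measure_singleton (μ := unitUniform) _)
  obtain ⟨x, hx, hx'⟩ := (h2.and h3).exists
  exact hx' hx

lemma strictMono_tiltedMean : StrictMono tiltedMean :=
  strictMono_of_deriv_pos tiltedVar_pos

lemma exp_uniformCgf (t : ℝ) : Real.exp (uniformCgf t) = mgf id unitUniform t :=
  exp_cgf (integrable_exp_mul_unitUniform t)

lemma exp_sub_one_ne_zero {t : ℝ} (ht : t ≠ 0) : Real.exp t - 1 ≠ 0 := by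
  simpa [sub_eq_zero] using ht

lemma mgf_unitUniform {t : ℝ} (ht : t ≠ 0) : mgf id unitUniform t = (Real.exp t - 1) / t := by
  simp only [mgf, id]
  rw [integral_Icc_eq_integral_Ioc, ← intervalIntegral.integral_of_le zero_le_one,
    intervalIntegral.integral_comp_mul_left (fun x ↦ Real.exp x) ht, integral_exp]
  simp [div_eq_inv_mul]

lemma tiltedMean_of_ne_zero {t : ℝ} (ht : t ≠ 0) :
    tiltedMean t = Real.exp t / (Real.exp t - 1) - 1 / t := by
  have h1 : uniformCgf =ᶠ[𝓝 t] fun s ↦ Real.log ((Real.exp s - 1) / s) := by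
    filter_upwards [isOpen_ne.mem_nhds ht] with s hs
    rw [uniformCgf, cgf, mgf_unitUniform hs]
  have he := exp_sub_one_ne_zero ht
  rw [tiltedMean, h1.deriv_eq]
  have h2 : HasDerivAt (fun s ↦ Real.log ((Real.exp s - 1) / s))
      (((Real.exp t * t - (Real.exp t - 1) * 1) / t ^ 2) / ((Real.exp t - 1) / t)) t :=
    ((((Real.hasDerivAt_exp t).sub_const 1).div (hasDerivAt_id t) ht).log (div_ne_zero he ht))
  rw [h2.deriv]
  field_simp

lemma tiltedMean_zero : tiltedMean 0 = 1 / 2 := by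
  rw [tiltedMean, deriv_cgf_zero (mem_interior_integrableExpSet_unitUniform 0)]
  simp only [probReal_univ, id, div_one]
  rw [integral_Icc_eq_integral_Ioc, ← intervalIntegral.integral_of_le zero_le_one, integral_id]
  norm_num

lemma tiltedVar_zero : tiltedVar 0 = 1 / 12 := by
  rw [tiltedVar_eq_iteratedDeriv,
    iteratedDeriv_two_cgf (mem_interior_integrableExpSet_unitUniform 0)]
  have h : deriv (cgf id unitUniform) 0 = 1 / 2 := tiltedMean_zero
  rw [h]
  simp only [id, zero_mul, Real.exp_zero, mul_one, mgf_zero, div_one]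
  rw [integral_Icc_eq_integral_Ioc, ← intervalIntegral.integral_of_le zero_le_one, integral_pow]
  norm_num

/-! ### The parametrization by `z = exp (-t)` -/

lemma log_ne_zero_of_pos {z : ℝ} (hz : 0 < z) (h1 : z ≠ 1) : Real.log z ≠ 0 :=
  Real.log_ne_zero_of_pos_of_ne_one hz h1

lemma betaParam_eq {z : ℝ} (hz : 0 < z) : betaParam z = tiltedMean (-Real.log z) := by
  unfold betaParam
  split_ifs with h
  · simp [h, tiltedMean_zero]
  · have hl := log_ne_zero_of_pos hz h
    have h' : 1 - z ≠ 0 := sub_ne_zero.2 (Ne.symm h)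
    rw [tiltedMean_of_ne_zero (neg_ne_zero.2 hl), Real.exp_neg, Real.exp_log hz]
    have : z⁻¹ - 1 = (1 - z) / z := by field_simp
    rw [this]
    field_simp
    ring

/-- The exponential rate of the slab volume as a function of the tilt. -/
noncomputable def slabRate (t : ℝ) : ℝ := Real.exp (uniformCgf t - t * tiltedMean t)

lemma slabRate_pos (t : ℝ) : 0 < slabRate t := Real.exp_pos _

lemma slabRate_zero : slabRate 0 = 1 := by simp [slabRate]

lemma continuous_slabRate : Continuous slabRate :=
  Real.continuous_exp.comp
    (continuous_uniformCgf.sub (continuous_id.mul continuous_tiltedMean))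

lemma fParam_eq {z : ℝ} (hz : 0 < z) : fParam z = slabRate (-Real.log z) := by
  unfold fParam
  split_ifs with h
  · simp [h, slabRate_zero]
  · have hl := log_ne_zero_of_pos hz h
    have h' : 1 - z ≠ 0 := sub_ne_zero.2 (Ne.symm h)
    rw [slabRate, Real.exp_sub, exp_uniformCgf, mgf_unitUniform (neg_ne_zero.2 hl), Real.exp_neg,
      Real.exp_log hz, ← betaParam_eq hz, betaParam, if_neg h]
    -- This is `t * tiltedMean t` at `t = -log z`, split so that dividing by its exponential yields
    -- the factors `z ^ (z / (1 - z))`, `z` and `e`.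
    have h2 : -Real.log z * (1 / (1 - z) + 1 / Real.log z)
        = -(Real.log z * (z / (1 - z)) + Real.log z + 1) := by
      field_simp
      ring
    rw [h2, Real.exp_neg, Real.exp_add, Real.exp_add, Real.exp_log hz, Real.rpow_def_of_pos hz]
    field_simp
    ring

lemma betaParam_exp_neg (t : ℝ) : betaParam (Real.exp (-t)) = tiltedMean t := by
  rw [betaParam_eq (Real.exp_pos _), Real.log_exp, neg_neg]

lemma fParam_exp_neg (t : ℝ) : fParam (Real.exp (-t)) = slabRate t := by
  rw [fParam_eq (Real.exp_pos _), Real.log_exp, neg_neg]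

lemma continuousOn_neg_log : ContinuousOn (fun z ↦ -Real.log z) (Ioi 0) :=
  (Real.continuousOn_log.mono fun _ hx ↦ ne_of_gt hx).neg

lemma continuousOn_betaParam : ContinuousOn betaParam (Ioi 0) :=
  (continuous_tiltedMean.comp_continuousOn continuousOn_neg_log).congr fun _ hz ↦ betaParam_eq hz

lemma continuousOn_fParam : ContinuousOn fParam (Ioi 0) :=
  (continuous_slabRate.comp_continuousOn continuousOn_neg_log).congr fun _ hz ↦ fParam_eq hz

lemma strictAntiOn_betaParam : StrictAntiOn betaParam (Ioi 0) := fun a ha b hb hab ↦ by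
  rw [betaParam_eq ha, betaParam_eq hb]
  exact strictMono_tiltedMean (neg_lt_neg (Real.log_lt_log ha hab))

lemma eventually_ne_one_nhdsGT_zero : ∀ᶠ z : ℝ in 𝓝[>] 0, z ≠ 1 :=
  nhdsWithin_le_nhds (isOpen_ne.mem_nhds zero_ne_one)

lemma tendsto_betaParam_zero : Tendsto betaParam (𝓝[>] 0) (𝓝 1) := by
  have h1 : Tendsto (fun z : ℝ ↦ 1 / (1 - z) + (Real.log z)⁻¹) (𝓝[>] 0) (𝓝 (1 / (1 - 0) + 0)) := by
    refine Tendsto.add ?_ (tendsto_inv_atBot_zero.comp Real.tendsto_log_nhdsGT_zero)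
    have : ContinuousAt (fun z : ℝ ↦ 1 / (1 - z)) 0 := by
      apply ContinuousAt.div <;> first | fun_prop | simp
    exact this.tendsto.mono_left nhdsWithin_le_nhds
  rw [sub_zero, div_one, add_zero] at h1
  refine h1.congr' ?_
  filter_upwards [eventually_ne_one_nhdsGT_zero] with z hz
  rw [betaParam, if_neg hz, one_div (Real.log z)]

lemma tendsto_betaParam_atTop : Tendsto betaParam atTop (𝓝 0) := by
  have h1 : Tendsto (fun z : ℝ ↦ (1 - z)⁻¹ + (Real.log z)⁻¹) atTop (𝓝 (0 + 0)) := by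
    refine Tendsto.add ?_ (tendsto_inv_atTop_zero.comp Real.tendsto_log_atTop)
    exact tendsto_inv_atBot_zero.comp (tendsto_const_nhds.add_atBot tendsto_neg_atTop_atBot)
  rw [add_zero] at h1
  refine h1.congr' ?_
  filter_upwards [eventually_ne_atTop 1] with z hz
  rw [betaParam, if_neg hz, one_div, one_div]

lemma tendsto_tiltedMean_atTop : Tendsto tiltedMean atTop (𝓝 1) := by
  refine Tendsto.congr betaParam_exp_neg ?_
  exact tendsto_betaParam_zero.comp (tendsto_nhdsWithin_iff.2
    ⟨Real.tendsto_exp_neg_atTop_nhds_zero, Eventually.of_forall fun _ ↦ Real.exp_pos _⟩)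

lemma tendsto_tiltedMean_atBot : Tendsto tiltedMean atBot (𝓝 0) := by
  refine Tendsto.congr betaParam_exp_neg ?_
  exact tendsto_betaParam_atTop.comp (Real.tendsto_exp_atTop.comp tendsto_neg_atBot_atTop)

lemma tiltedMean_mem_Ioo (t : ℝ) : tiltedMean t ∈ Ioo 0 1 := by
  have hm := strictMono_tiltedMean
  constructor
  · exact (hm.monotone.le_of_tendsto tendsto_tiltedMean_atBot (t - 1)).trans_lt (hm (by linarith))
  · exact (hm (by linarith)).trans_le (hm.monotone.ge_of_tendsto tendsto_tiltedMean_atTop (t + 1))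

lemma range_tiltedMean : range tiltedMean = Ioo 0 1 := by
  refine Subset.antisymm (range_subset_iff.2 tiltedMean_mem_Ioo) fun b hb ↦ ?_
  obtain ⟨s, hs⟩ := (tendsto_tiltedMean_atBot.eventually_lt_const hb.1).exists
  obtain ⟨u, hu⟩ := (tendsto_tiltedMean_atTop.eventually_const_lt hb.2).exists
  exact mem_range_of_exists_le_of_exists_ge continuous_tiltedMean ⟨s, hs.le⟩ ⟨u, hu.le⟩

lemma bijOn_betaParam : BijOn betaParam (Ioi 0) (Ioo 0 1) := by
  refine ⟨fun z hz ↦ ?_, strictAntiOn_betaParam.injOn, fun b hb ↦ ?_⟩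
  · rw [betaParam_eq hz]
    exact tiltedMean_mem_Ioo _
  · obtain ⟨t, rfl⟩ := range_tiltedMean.symm ▸ hb
    exact ⟨_, Real.exp_pos _, betaParam_exp_neg t⟩

lemma tendsto_fParam_zero : Tendsto fParam (𝓝[>] 0) (𝓝 0) := by
  have h1 : Tendsto (fun z : ℝ ↦ z ^ (z / (1 - z)) * (z - 1) * Real.exp 1 * (Real.log z)⁻¹)
      (𝓝[>] 0) (𝓝 (Real.exp (0 * (1 / (1 - 0))) * (0 - 1) * Real.exp 1 * 0)) := by
    refine Tendsto.mul (Tendsto.mul (Tendsto.mul ?_ ?_) tendsto_const_nhds)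
      (tendsto_inv_atBot_zero.comp Real.tendsto_log_nhdsGT_zero)
    · have h2 : Tendsto (fun z : ℝ ↦ Real.exp (Real.log z * z * (1 / (1 - z)))) (𝓝[>] 0)
          (𝓝 (Real.exp (0 * (1 / (1 - 0))))) := by
        refine (Real.continuous_exp.tendsto _).comp (Tendsto.mul ?_ ?_)
        · simpa [mul_comm] using
          (Real.continuous_mul_log.tendsto 0).mono_left (nhdsWithin_le_nhds (s := Ioi 0))
        · have : ContinuousAt (fun z : ℝ ↦ 1 / (1 - z)) 0 := by
            apply ContinuousAt.div <;> first | fun_prop | simp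
          exact this.tendsto.mono_left nhdsWithin_le_nhds
      refine h2.congr' ?_
      filter_upwards [self_mem_nhdsWithin] with z hz
      rw [Real.rpow_def_of_pos hz]
      congr 1
      ring
    · exact (continuous_id.sub continuous_const).continuousWithinAt (s := Ioi 0) (x := (0 : ℝ))
  rw [mul_zero] at h1
  refine h1.congr' ?_
  filter_upwards [eventually_ne_one_nhdsGT_zero] with z hz
  rw [fParam, if_neg hz, div_eq_mul_inv _ (Real.log z)]

lemma tendsto_fParam_atTop : Tendsto fParam atTop (𝓝 0) := by
  have h0 : Tendsto (fun z : ℝ ↦ z⁻¹) atTop (𝓝 0) := tendsto_inv_atTop_zero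
  have h3 : Tendsto (fun z : ℝ ↦ (z⁻¹ - 1)⁻¹) atTop (𝓝 (0 - 1)⁻¹) :=
    (h0.sub_const 1).inv₀ (by norm_num)
  have hl : Tendsto (fun z : ℝ ↦ Real.log z * z⁻¹) atTop (𝓝 0) :=
    (Real.isLittleO_log_id_atTop.tendsto_div_nhds_zero).congr fun z ↦ by simp [div_eq_mul_inv]
  have h1 : Tendsto (fun z : ℝ ↦ Real.exp (Real.log z * z⁻¹ * (z⁻¹ - 1)⁻¹) * (1 - z⁻¹) * Real.exp 1
      * (Real.log z)⁻¹) atTop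
      (𝓝 (Real.exp (0 * (0 - 1)⁻¹) * (1 - 0) * Real.exp 1 * 0)) :=
    (((((Real.continuous_exp.tendsto _).comp (hl.mul h3)).mul (h0.const_sub 1)).mul
      tendsto_const_nhds).mul (tendsto_inv_atTop_zero.comp Real.tendsto_log_atTop))
  rw [mul_zero] at h1
  refine h1.congr' ?_
  filter_upwards [eventually_gt_atTop 1] with z hz
  have hz0 : 0 < z := zero_lt_one.trans hz
  have h' : 1 - z ≠ 0 := (sub_neg.2 hz).ne
  -- Since `z / (1 - z) = 1 / (1 - z) - 1`, a factor `z⁻¹` splits off the power and compensates the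
  -- growth of `z - 1`.
  have h2 : Real.log z * (z / (1 - z)) = Real.log z * z⁻¹ * (z⁻¹ - 1)⁻¹ + - Real.log z := by
    have : (z⁻¹ - 1)⁻¹ = z / (1 - z) := by
      rw [show z⁻¹ - 1 = (1 - z) / z by field_simp, inv_div]
    rw [this]
    field_simp
    ring
  rw [fParam, if_neg hz.ne', div_eq_mul_inv _ (Real.log z), Real.rpow_def_of_pos hz0, h2,
    Real.exp_add, Real.exp_neg, Real.exp_log hz0]
  field_simp

/-! ### The inverse of the mean, and the functions `A` and `f` -/

/-- A nonvanishing derivative makes the map open, so together with injectivity there is a global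
inverse on the range `(0,1)`, to which the inverse function theorem applies. -/
lemma isOpenEmbedding_tiltedMean : IsOpenEmbedding tiltedMean :=
  .of_continuous_injective_isOpenMap continuous_tiltedMean strictMono_tiltedMean.injective
    (isOpenMap_of_hasStrictDerivAt hasStrictDerivAt_tiltedMean fun t ↦ (tiltedVar_pos t).ne')

/-- The tilt for which the tilted uniform distribution has a given mean in `(0,1)`. -/
noncomputable def tiltOf : ℝ → ℝ := (isOpenEmbedding_tiltedMean.toOpenPartialHomeomorph tiltedMean).symm

lemma tiltOf_tiltedMean (t : ℝ) : tiltOf (tiltedMean t) = t :=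
  isOpenEmbedding_tiltedMean.toOpenPartialHomeomorph_left_inv

lemma tiltedMean_tiltOf {b : ℝ} (hb : b ∈ Ioo 0 1) : tiltedMean (tiltOf b) = b :=
  isOpenEmbedding_tiltedMean.toOpenPartialHomeomorph_right_inv _ (range_tiltedMean.symm ▸ hb)

lemma tiltOf_half : tiltOf (1 / 2) = 0 := by rw [← tiltedMean_zero, tiltOf_tiltedMean]

lemma contDiffAt_tiltOf {b : ℝ} (hb : b ∈ Ioo 0 1) : ContDiffAt ℝ 1 tiltOf b := by
  refine OpenPartialHomeomorph.contDiffAt_symm_deriv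
    (isOpenEmbedding_tiltedMean.toOpenPartialHomeomorph tiltedMean) (f₀' := tiltedVar (tiltOf b))
    (tiltedVar_pos _).ne' ?_ ?_ ?_
  · rw [Topology.IsOpenEmbedding.toOpenPartialHomeomorph_target, range_tiltedMean]
    exact hb
  · rw [Topology.IsOpenEmbedding.toOpenPartialHomeomorph_apply]
    exact (hasStrictDerivAt_tiltedMean _).hasDerivAt
  · rw [Topology.IsOpenEmbedding.toOpenPartialHomeomorph_apply]
    exact (analyticAt_tiltedMean _).contDiffAt

lemma tendsto_tiltOf_zero : Tendsto tiltOf (𝓝[>] 0) atBot := by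
  refine tendsto_atBot.2 fun t ↦ ?_
  filter_upwards [Ioo_mem_nhdsGT (tiltedMean_mem_Ioo t).1] with b hb
  rw [← strictMono_tiltedMean.le_iff_le,
    tiltedMean_tiltOf ⟨hb.1, hb.2.trans (tiltedMean_mem_Ioo t).2⟩]
  exact hb.2.le

lemma tendsto_tiltOf_one : Tendsto tiltOf (𝓝[<] 1) atTop := by
  refine tendsto_atTop.2 fun t ↦ ?_
  filter_upwards [Ioo_mem_nhdsLT (tiltedMean_mem_Ioo t).2] with b hb
  rw [← strictMono_tiltedMean.le_iff_le,
    tiltedMean_tiltOf ⟨(tiltedMean_mem_Ioo t).1.trans hb.1, hb.2⟩]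
  exact hb.1.le

/-- The base of the exponential factor in the slab asymptotics. -/
noncomputable def slabBase : ℝ → ℝ := (Ioo 0 1).indicator fun b ↦ slabRate (tiltOf b)

/-- The constant in the slab asymptotics. Its values outside `(0,1)` are irrelevant. -/
noncomputable def slabConst (b : ℝ) : ℝ := (√(2 * Real.pi * tiltedVar (tiltOf b)))⁻¹

lemma slabConst_pos (b : ℝ) : 0 < slabConst b := by
  have := tiltedVar_pos (tiltOf b)
  unfold slabConst
  positivity

lemma slabConst_half : slabConst (1 / 2) = √(6 / Real.pi) := by
  rw [slabConst, tiltOf_half, tiltedVar_zero, ← Real.sqrt_inv]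
  congr 1
  field_simp
  norm_num

lemma contDiffOn_slabConst : ContDiffOn ℝ 1 slabConst (Ioo 0 1) := fun b hb ↦ by
  have hv := tiltedVar_pos (tiltOf b)
  have h : ContDiffAt ℝ 1 (fun b ↦ 2 * Real.pi * tiltedVar (tiltOf b)) b :=
    contDiffAt_const.mul ((analyticAt_tiltedVar _).contDiffAt.comp b (contDiffAt_tiltOf hb))
  exact ((h.sqrt (by positivity)).inv (by positivity)).contDiffWithinAt

lemma slabBase_tiltedMean (t : ℝ) : slabBase (tiltedMean t) = slabRate t := by
  rw [slabBase, indicator_of_mem (tiltedMean_mem_Ioo t), tiltOf_tiltedMean]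

lemma slabBase_betaParam {z : ℝ} (hz : 0 < z) : slabBase (betaParam z) = fParam z := by
  rw [betaParam_eq hz, slabBase_tiltedMean, fParam_eq hz]

lemma slabBase_zero : slabBase 0 = 0 := by simp [slabBase]

lemma slabBase_one : slabBase 1 = 0 := by simp [slabBase]

lemma slabBase_half : slabBase (1 / 2) = 1 := by
  rw [← tiltedMean_zero, slabBase_tiltedMean, slabRate_zero]

lemma slabBase_pos {b : ℝ} (hb : b ∈ Ioo 0 1) : 0 < slabBase b := by
  rw [slabBase, indicator_of_mem hb]
  exact slabRate_pos _

lemma tendsto_slabRate_atBot : Tendsto slabRate atBot (𝓝 0) := by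
  refine Tendsto.congr fParam_exp_neg ?_
  exact tendsto_fParam_atTop.comp (Real.tendsto_exp_atTop.comp tendsto_neg_atBot_atTop)

lemma tendsto_slabRate_atTop : Tendsto slabRate atTop (𝓝 0) := by
  refine Tendsto.congr fParam_exp_neg ?_
  exact tendsto_fParam_zero.comp (tendsto_nhdsWithin_iff.2
    ⟨Real.tendsto_exp_neg_atTop_nhds_zero, Eventually.of_forall fun _ ↦ Real.exp_pos _⟩)

lemma continuousOn_slabBase : ContinuousOn slabBase (Icc 0 1) := by
  have h : ∀ b ∈ Ioo (0 : ℝ) 1, slabBase b = slabRate (tiltOf b) := fun b hb ↦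
    indicator_of_mem hb _
  intro b hb
  rcases eq_or_lt_of_le hb.1 with rfl | h0
  · refine ContinuousWithinAt.mono (continuousWithinAt_Ioi_iff_Ici.1 ?_) Icc_subset_Ici_self
    rw [ContinuousWithinAt, slabBase_zero]
    refine (tendsto_slabRate_atBot.comp tendsto_tiltOf_zero).congr' ?_
    filter_upwards [Ioo_mem_nhdsGT zero_lt_one] with b hb using (h b hb).symm
  rcases eq_or_lt_of_le hb.2 with rfl | h1
  · refine ContinuousWithinAt.mono (continuousWithinAt_Iio_iff_Iic.1 ?_) Icc_subset_Iic_self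
    rw [ContinuousWithinAt, slabBase_one]
    refine (tendsto_slabRate_atTop.comp tendsto_tiltOf_one).congr' ?_
    filter_upwards [Ioo_mem_nhdsLT zero_lt_one] with b hb using (h b hb).symm
  · have hc : ContinuousAt (fun b ↦ slabRate (tiltOf b)) b :=
      continuous_slabRate.continuousAt.comp (contDiffAt_tiltOf ⟨h0, h1⟩).continuousAt
    refine (hc.congr ?_).continuousWithinAt
    filter_upwards [isOpen_Ioo.mem_nhds ⟨h0, h1⟩] with b hb using (h b hb).symm

/-! ### Decay of the characteristic functions of the tilted uniform distributions -/

lemma complexMGF_unitUniform {w : ℂ} (hw : w ≠ 0) :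
    complexMGF id unitUniform w = (Complex.exp w - 1) / w := by
  simp only [complexMGF, id]
  rw [integral_Icc_eq_integral_Ioc, ← intervalIntegral.integral_of_le zero_le_one,
    integral_exp_mul_complex hw]
  simp

/-- After division by `4 exp t` this is `(t/2)² < sinh² (t/2)`. The strict gap provides the positive
decay constant for `t ≠ 0`. -/
lemma exp_mul_sq_lt_exp_sub_one_sq {t : ℝ} (ht : t ≠ 0) :
    Real.exp t * t ^ 2 < (Real.exp t - 1) ^ 2 := by
  have h1 : |t / 2| < |Real.sinh (t / 2)| := by
    rw [Real.abs_sinh, Real.self_lt_sinh_iff]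
    positivity
  have h2 := sq_lt_sq.2 h1
  have h3 : Real.exp t = Real.exp (t / 2) ^ 2 := by rw [← Real.exp_nat_mul]; congr 1; norm_num; ring
  have h4 : Real.exp t - 1 = Real.exp (t / 2) * (2 * Real.sinh (t / 2)) := by
    rw [Real.sinh_eq, Real.exp_neg, h3]
    field_simp
  rw [h4, h3]
  have := mul_lt_mul_of_pos_left h2 (pow_pos (Real.exp_pos (t / 2)) 2)
  nlinarith

lemma normSq_exp_add_mul_I_sub_one (t s : ℝ) :
    ‖Complex.exp (t + s * Complex.I) - 1‖ ^ 2 =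
      (Real.exp t - 1) ^ 2 + 2 * Real.exp t * (1 - Real.cos s) := by
  rw [← Complex.normSq_eq_norm_sq, Complex.normSq_apply]
  simp only [Complex.sub_re, Complex.sub_im, Complex.exp_re, Complex.exp_im, Complex.add_re,
    Complex.add_im, Complex.ofReal_re, Complex.ofReal_im, Complex.mul_re, Complex.mul_im,
    Complex.I_re, Complex.I_im, Complex.one_re, Complex.one_im, mul_zero, mul_one,
    sub_zero, add_zero, zero_add]
  linear_combination Real.exp t ^ 2 * Real.sin_sq_add_cos_sq s

lemma normSq_add_mul_I (t s : ℝ) : ‖(t + s * Complex.I : ℂ)‖ ^ 2 = t ^ 2 + s ^ 2 := by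
  rw [← Complex.normSq_eq_norm_sq, Complex.normSq_add_mul_I]

/-- With `s = 4v` the claim becomes `sin² v cos² v (1 + v²) ≤ v²`. For `|v| ≤ 1` it follows from
`cos² v ≤ 1 / (1 + v²)` and `|sin v| ≤ |v|`; for `|v| > 1`, from `4 sin² v cos² v ≤ 1`. -/
lemma two_mul_one_sub_cos_mul_le (s : ℝ) : 2 * (1 - Real.cos s) * (1 + 1 / 16 * s ^ 2) ≤ s ^ 2 := by
  obtain ⟨v, rfl⟩ : ∃ v, s = 4 * v := ⟨s / 4, by ring⟩
  have h1 : 2 * (1 - Real.cos (4 * v)) = 16 * Real.sin v ^ 2 * Real.cos v ^ 2 := by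
    rw [show 4 * v = 2 * (2 * v) by ring, Real.cos_two_mul, Real.cos_two_mul]
    nlinarith [Real.sin_sq_add_cos_sq v]
  rw [h1]
  have hsc := Real.sin_sq_add_cos_sq v
  rcases le_or_gt |v| 1 with hv | hv
  · obtain ⟨hv1, hv2⟩ := abs_le.1 hv
    have hpi := Real.pi_gt_three
    have hc := Real.cos_le_one_div_sqrt_sq_add_one (x := v) (by linarith) (by linarith)
    have hc0 : 0 ≤ Real.cos v := Real.cos_nonneg_of_mem_Icc ⟨by linarith, by linarith⟩
    have hc2 : Real.cos v ^ 2 * (v ^ 2 + 1) ≤ 1 := by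
      have h := pow_le_pow_left₀ hc0 hc 2
      rw [div_pow, Real.sq_sqrt (by positivity), one_pow, le_div_iff₀ (by positivity)] at h
      exact h
    have hs : Real.sin v ^ 2 ≤ v ^ 2 := sq_le_sq.2 Real.abs_sin_le_abs
    have := mul_le_mul hs hc2 (by positivity) (by positivity)
    nlinarith
  · have hv2 : 1 ≤ v ^ 2 := by nlinarith [sq_abs v]
    have h4 : 4 * (Real.sin v ^ 2 * Real.cos v ^ 2) ≤ 1 := by
      nlinarith [sq_nonneg (Real.sin v ^ 2 - Real.cos v ^ 2)]
    nlinarith [mul_le_mul_of_nonneg_right h4 (by positivity : 0 ≤ 1 + v ^ 2)]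

lemma exists_normSq_complexMGF_mul_le (t : ℝ) : ∃ c > 0, ∀ s : ℝ,
    ‖complexMGF id unitUniform (t + s * Complex.I)‖ ^ 2 * (1 + c * s ^ 2) ≤
      mgf id unitUniform t ^ 2 := by
  rcases eq_or_ne t 0 with rfl | ht
  · refine ⟨1 / 16, by norm_num, fun s ↦ ?_⟩
    rcases eq_or_ne s 0 with rfl | hs
    · simp [complexMGF, mgf]
    · have hw : ((0 : ℝ) + s * Complex.I : ℂ) ≠ 0 := by simp [hs]
      rw [complexMGF_unitUniform hw, norm_div, div_pow, normSq_exp_add_mul_I_sub_one,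
        normSq_add_mul_I, mgf_zero, div_mul_eq_mul_div, div_le_iff₀ (by positivity)]
      simpa using two_mul_one_sub_cos_mul_le s
  · have hE := exp_mul_sq_lt_exp_sub_one_sq ht
    set E := (Real.exp t - 1) ^ 2 with hEdef
    have hB : 0 < Real.exp t := Real.exp_pos t
    have ht2 : 0 < t ^ 2 := by positivity
    have hE0 : 0 < E := lt_trans (by positivity) hE
    -- After clearing denominators, `1 - cos s` is bounded by `s² / 2` in the term without `c` and
    -- by `2` in the term with `c`. This `c` makes the resulting coefficients of `s²` equal.
    refine ⟨(E - Real.exp t * t ^ 2) / (t ^ 2 * (E + 4 * Real.exp t)),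
      div_pos (sub_pos.2 hE) (by positivity), fun s ↦ ?_⟩
    set c := (E - Real.exp t * t ^ 2) / (t ^ 2 * (E + 4 * Real.exp t)) with hc
    have hc0 : 0 < c := div_pos (sub_pos.2 hE) (by positivity)
    have hceq : c * (t ^ 2 * (E + 4 * Real.exp t)) = E - Real.exp t * t ^ 2 :=
      div_mul_cancel₀ _ (by positivity)
    have hw : (t + s * Complex.I : ℂ) ≠ 0 := fun h ↦ ht (by simpa using congrArg Complex.re h)
    rw [complexMGF_unitUniform hw, norm_div, div_pow, normSq_exp_add_mul_I_sub_one,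
      normSq_add_mul_I, mgf_unitUniform ht, div_pow, ← hEdef, div_mul_eq_mul_div,
      div_le_div_iff₀ (by positivity) ht2]
    have hu1 : 1 - Real.cos s ≤ s ^ 2 / 2 := by linarith [Real.one_sub_sq_div_two_le_cos (x := s)]
    have hu2 : 1 - Real.cos s ≤ 2 := by linarith [Real.neg_one_le_cos s]
    have e1 : 2 * Real.exp t * (1 - Real.cos s) * t ^ 2 ≤ 2 * Real.exp t * (s ^ 2 / 2) * t ^ 2 := by
      gcongr
    have e2 : 2 * Real.exp t * (1 - Real.cos s) * (c * s ^ 2) * t ^ 2 ≤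
        2 * Real.exp t * 2 * (c * s ^ 2) * t ^ 2 := by gcongr
    have e3 := congrArg (· * s ^ 2) hceq
    linarith

lemma charFun_tiltedUniform (t s : ℝ) : charFun (tiltedUniform t) s =
    complexMGF id unitUniform (t + s * Complex.I) / mgf id unitUniform t := by
  rw [charFun_apply_real, integral_tilted_mul_eq_mgf, complexMGF, ← integral_div]
  congr with x
  simp only [id, Complex.real_smul]
  push_cast
  rw [add_mul, Complex.exp_add]
  ring_nf

lemma mgf_unitUniform_pos (t : ℝ) : 0 < mgf id unitUniform t :=
  mgf_pos (integrable_exp_mul_unitUniform t)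

lemma exists_normSq_charFun_mul_le (t : ℝ) : ∃ c > 0, ∀ s : ℝ,
    ‖charFun (tiltedUniform t) s‖ ^ 2 * (1 + c * s ^ 2) ≤ 1 := by
  obtain ⟨c, hc, h⟩ := exists_normSq_complexMGF_mul_le t
  refine ⟨c, hc, fun s ↦ ?_⟩
  have hm := mgf_unitUniform_pos t
  rw [charFun_tiltedUniform, norm_div, div_pow, Complex.norm_real, Real.norm_eq_abs, sq_abs,
    div_mul_eq_mul_div, div_le_one (by positivity)]
  exact h s

/-! ### A local limit theorem for characteristic functions with quadratic decay -/

lemma integrable_inv_one_add_mul_sq {c : ℝ} (hc : 0 < c) :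
    Integrable fun s : ℝ ↦ (1 + c * s ^ 2)⁻¹ := by
  refine (integrable_inv_one_add_sq.comp_mul_left' (Real.sqrt_pos.2 hc).ne').congr
    (.of_forall fun s ↦ ?_)
  simp only [mul_pow, Real.sq_sqrt hc.le]

/-- Bernoulli's inequality for `(1 + y) ^ (n / 2)`; the exponent is halved because the hypothesis
controls `a ^ 2`. -/
lemma pow_le_inv_one_add_mul {a y : ℝ} (ha : 0 ≤ a) (hy : 0 ≤ y) (h : a ^ 2 * (1 + y) ≤ 1)
    (n : ℕ) : a ^ n ≤ (1 + (n / 2 : ℕ) * y)⁻¹ := by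
  have ha1 : a ≤ 1 := by nlinarith [sq_nonneg a]
  calc a ^ n ≤ a ^ (2 * (n / 2)) := pow_le_pow_of_le_one ha ha1 (Nat.mul_div_le n 2)
    _ = (a ^ 2) ^ (n / 2) := pow_mul _ _ _
    _ ≤ ((1 + y)⁻¹) ^ (n / 2) := by
      gcongr
      rwa [← one_div, le_div_iff₀ (by positivity)]
    _ = ((1 + y) ^ (n / 2))⁻¹ := inv_pow _ _
    _ ≤ _ := by
      gcongr
      exact one_add_mul_le_pow (by linarith) _

lemma integrable_pow_of_normSq_mul_le {φ : ℝ → ℂ} (hφ : Continuous φ) {c : ℝ} (hc : 0 < c)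
    (h : ∀ s, ‖φ s‖ ^ 2 * (1 + c * s ^ 2) ≤ 1) {n : ℕ} (hn : 2 ≤ n) :
    Integrable fun s ↦ φ s ^ n := by
  refine (integrable_inv_one_add_mul_sq hc).mono' (hφ.pow n).aestronglyMeasurable
    (.of_forall fun s ↦ ?_)
  rw [norm_pow]
  refine (pow_le_inv_one_add_mul (norm_nonneg _) (by positivity) (h s) n).trans ?_
  refine inv_anti₀ (by positivity) ((add_le_add_iff_left 1).2 ?_)
  have : (1 : ℝ) ≤ (n / 2 : ℕ) := by exact_mod_cast (by omega : 1 ≤ n / 2)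
  nlinarith [mul_nonneg hc.le (sq_nonneg s)]

theorem tendsto_integral_charFun_pow {Ω : Type*} {mΩ : MeasurableSpace Ω} {P : Measure Ω}
    [IsProbabilityMeasure P] {X : Ω → ℝ} (hX : AEMeasurable X P) (h0 : P[X] = 0)
    (h1 : P[X ^ 2] = 1) {c : ℝ} (hc : 0 < c)
    (h : ∀ s, ‖charFun (P.map X) s‖ ^ 2 * (1 + c * s ^ 2) ≤ 1) :
    Tendsto (fun n : ℕ ↦ ∫ s : ℝ, charFun (P.map X) ((√n)⁻¹ * s) ^ n) atTop
      (𝓝 (√(2 * Real.pi) : ℝ)) := by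
  have := Measure.isProbabilityMeasure_map hX
  have hg : ∫ s : ℝ, Complex.exp (-s ^ 2 / 2) = (√(2 * Real.pi) : ℝ) := by
    have h2 := integral_gaussian (1 / 2)
    rw [show Real.pi / (1 / 2) = 2 * Real.pi by ring] at h2
    rw [← h2, ← integral_complex_ofReal]
    congr with s
    push_cast
    congr 1
    ring
  rw [← hg]
  refine tendsto_integral_filter_of_dominated_convergence (fun s ↦ (1 + c / 3 * s ^ 2)⁻¹)
    (.of_forall fun n ↦ ?_) ?_ (integrable_inv_one_add_mul_sq (by positivity))
    (.of_forall fun s ↦ tendsto_charFun_inv_sqrt_mul_pow hX h0 h1 s)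
  · exact ((continuous_charFun.comp (continuous_const.mul continuous_id)).pow n).aestronglyMeasurable
  · filter_upwards [eventually_ge_atTop 2] with n hn
    refine .of_forall fun s ↦ ?_
    have hn0 : (0 : ℝ) < n := by exact_mod_cast (by omega : 0 < n)
    rw [norm_pow]
    refine (pow_le_inv_one_add_mul (norm_nonneg _) (by positivity) (h _) n).trans ?_
    refine inv_anti₀ (by positivity) ((add_le_add_iff_left 1).2 ?_)
    rw [mul_pow, inv_pow, Real.sq_sqrt hn0.le]
    -- The rounded half satisfies `n / 2 ≥ n / 3` for `n ≥ 2`, with equality at `n = 3`; hence `c /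
    -- 3` in the dominating function.
    have h3 : (n : ℝ) ≤ 3 * (n / 2 : ℕ) := by exact_mod_cast (by omega : n ≤ 3 * (n / 2))
    have : ((n / 2 : ℕ) : ℝ) * (c * ((n : ℝ)⁻¹ * s ^ 2)) - c / 3 * s ^ 2 =
        c * s ^ 2 * (3 * (n / 2 : ℕ) - n) / (3 * n) := by
      field_simp
    rw [← sub_nonneg, this]
    have := sub_nonneg.2 h3
    positivity

/-! ### The slab volume as a density, and its Fourier representation -/

/-- The uniform distribution on the `n`-dimensional unit cube. -/
noncomputable abbrev cubeUniform (n : ℕ) : Measure (Fin n → ℝ) := Measure.pi fun _ ↦ unitUniform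

/-- The volume of `{y ∈ [0,1]^n : x - 1 ≤ ∑ y_j ≤ x}`; this is the density at `x` of a sum of
`n + 1` independent uniform variables. -/
noncomputable def sectionVolume (n : ℕ) (x : ℝ) : ℝ :=
  ∫ y : Fin n → ℝ, (Icc (0 : ℝ) 1).indicator 1 (x - ∑ j, y j) ∂(cubeUniform n)

lemma slabVolume_eq_sectionVolume (N : ℕ) (b : ℝ) :
    slabVolume N b = sectionVolume (N - 1) (b * N) := by
  have hm : MeasurableSet {y : Fin (N - 1) → ℝ | b * N - ∑ j, y j ∈ Icc (0 : ℝ) 1} :=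
    measurableSet_Icc.preimage (f := fun y : Fin (N - 1) → ℝ ↦ b * N - ∑ j, y j) (by fun_prop)
  have h1 : slab N b = {y : Fin (N - 1) → ℝ | b * N - ∑ j, y j ∈ Icc (0 : ℝ) 1} ∩
      univ.pi fun _ ↦ Icc (0 : ℝ) 1 := by
    ext y
    simp only [slab, mem_ofPred_eq, mem_inter_iff, mem_Icc, mem_univ_pi, sub_nonneg]
    constructor
    · rintro ⟨h, h1, h2⟩
      exact ⟨⟨h2, by linarith⟩, h⟩
    · rintro ⟨⟨h1, h2⟩, h⟩
      exact ⟨h, by linarith, h1⟩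
  have h2 : (fun y : Fin (N - 1) → ℝ ↦ (Icc (0 : ℝ) 1).indicator (1 : ℝ → ℝ) (b * N - ∑ j, y j)) =
      {y : Fin (N - 1) → ℝ | b * N - ∑ j, y j ∈ Icc (0 : ℝ) 1}.indicator 1 := by
    ext y
    simp [indicator]
  rw [sectionVolume, h2, integral_indicator_one hm, slabVolume, h1, ← Measure.restrict_apply hm,
    volume_pi, Measure.restrict_pi_pi]
  rfl

/-- The integrand of the exponentially weighted section volume. -/
noncomputable def sectionKernel (n : ℕ) (w : ℂ) (x : ℝ) (y : Fin n → ℝ) : ℂ :=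
  Complex.exp (w * x) * (((Icc (0 : ℝ) 1).indicator 1 (x - ∑ j, y j) : ℝ) : ℂ)

/-- Splitting `x = (x - ∑ y_j) + ∑ y_j` in the exponent separates the variables, so that Fubini
turns the transform of the density into a product of `n + 1` equal factors. -/
lemma sectionKernel_eq (n : ℕ) (w : ℂ) (x : ℝ) (y : Fin n → ℝ) :
    sectionKernel n w x y =
      (Icc (0 : ℝ) 1).indicator (fun u : ℝ ↦ Complex.exp (w * u)) (x - ∑ j, y j) *
        ∏ j, Complex.exp (w * y j) := by
  rw [sectionKernel, ← Complex.exp_sum]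
  by_cases h : x - ∑ j, y j ∈ Icc (0 : ℝ) 1
  · rw [indicator_of_mem h, indicator_of_mem h, ← Complex.exp_add]
    simp only [Pi.one_apply, Complex.ofReal_one, mul_one]
    congr 1
    rw [← Finset.mul_sum]
    push_cast
    ring
  · rw [indicator_of_notMem h, indicator_of_notMem h]
    simp

lemma integral_sectionKernel (n : ℕ) (w : ℂ) (x : ℝ) :
    ∫ y, sectionKernel n w x y ∂(cubeUniform n) = Complex.exp (w * x) * sectionVolume n x := by
  simp only [sectionKernel, sectionVolume]
  rw [integral_const_mul, integral_complex_ofReal]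

lemma measurable_sectionKernel (n : ℕ) (w : ℂ) :
    Measurable (Function.uncurry (sectionKernel n w)) := by
  unfold sectionKernel Function.uncurry
  have h : Measurable ((Icc (0 : ℝ) 1).indicator (1 : ℝ → ℝ)) :=
    measurable_one.indicator measurableSet_Icc
  have h2 : Measurable fun p : ℝ × (Fin n → ℝ) ↦ p.1 - ∑ j, p.2 j := by fun_prop
  exact (by fun_prop : Measurable fun p : ℝ × (Fin n → ℝ) ↦ Complex.exp (w * p.1)).mul
    (Complex.measurable_ofReal.comp (h.comp h2))

lemma integrable_cexp_unitUniform (w : ℂ) :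
    Integrable (fun u : ℝ ↦ Complex.exp (w * u)) unitUniform :=
  integrable_unitUniform_of_continuous (by fun_prop)

lemma integrable_indicator_cexp (w : ℂ) :
    Integrable ((Icc (0 : ℝ) 1).indicator (fun u : ℝ ↦ Complex.exp (w * u))) :=
  (integrable_indicator_iff measurableSet_Icc).2 (integrable_cexp_unitUniform w)

lemma integrable_prod_cexp (n : ℕ) (w : ℂ) :
    Integrable (fun y : Fin n → ℝ ↦ ∏ j, Complex.exp (w * y j)) (cubeUniform n) :=
  Integrable.fintype_prod (f := fun _ (u : ℝ) ↦ Complex.exp (w * u)) fun _ ↦ integrable_cexp_unitUniform w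

lemma integrable_sectionKernel (n : ℕ) (w : ℂ) :
    Integrable (Function.uncurry (sectionKernel n w)) (volume.prod (cubeUniform n)) := by
  refine (integrable_prod_iff' (measurable_sectionKernel n w).aestronglyMeasurable).2 ⟨?_, ?_⟩
  · refine .of_forall fun y ↦ ?_
    simp only [Function.uncurry, sectionKernel_eq]
    exact ((integrable_indicator_cexp w).comp_sub_right _).mul_const _
  · simp only [Function.uncurry, sectionKernel_eq, norm_mul]
    refine ((integrable_prod_cexp n w).norm.const_mul (∫ u : ℝ,
      ‖(Icc (0 : ℝ) 1).indicator (fun u : ℝ ↦ Complex.exp (w * u)) u‖)).congr (.of_forall fun y ↦ ?_)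
    dsimp only
    rw [integral_mul_const, integral_sub_right_eq_self (fun u : ℝ ↦
      ‖(Icc (0 : ℝ) 1).indicator (fun u : ℝ ↦ Complex.exp (w * u)) u‖)]

lemma integrable_exp_mul_sectionVolume (n : ℕ) (w : ℂ) :
    Integrable fun x : ℝ ↦ Complex.exp (w * x) * sectionVolume n x := by
  simp_rw [← integral_sectionKernel]
  exact (integrable_sectionKernel n w).integral_prod_left

lemma integral_exp_mul_sectionVolume (n : ℕ) (w : ℂ) :
    ∫ x : ℝ, Complex.exp (w * x) * sectionVolume n x = complexMGF id unitUniform w ^ (n + 1) := by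
  simp_rw [← integral_sectionKernel]
  rw [integral_integral_swap (integrable_sectionKernel n w)]
  simp_rw [sectionKernel_eq, integral_mul_const]
  have h (y : Fin n → ℝ) : ∫ x : ℝ, (Icc (0 : ℝ) 1).indicator
      (fun u : ℝ ↦ Complex.exp (w * u)) (x - ∑ j, y j) = complexMGF id unitUniform w := by
    rw [integral_sub_right_eq_self
      ((Icc (0 : ℝ) 1).indicator fun u : ℝ ↦ Complex.exp (w * u)),
      integral_indicator measurableSet_Icc]
    rfl
  simp_rw [h]
  rw [integral_const_mul, integral_fintype_prod_eq_pow (fun u : ℝ ↦ Complex.exp (w * u)),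
    Fintype.card_fin, pow_succ']
  rfl

lemma volume_sum_eq {n : ℕ} (hn : 1 ≤ n) (a : ℝ) :
    volume {y : Fin n → ℝ | ∑ j, y j = a} = 0 := by
  let f : (Fin n → ℝ) →ₗ[ℝ] ℝ := ∑ j, LinearMap.proj j
  have hf (y : Fin n → ℝ) : f y = ∑ j, y j := by simp [f]
  let s : AffineSubspace ℝ (Fin n → ℝ) := (affineSpan ℝ {a}).comap f.toAffineMap
  have hs : (s : Set (Fin n → ℝ)) = {y | ∑ j, y j = a} := by
    ext y
    simp [s, hf]
  rw [← hs]
  refine Measure.addHaar_affineSubspace _ s fun h ↦ ?_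
  -- A point with coordinate sum `a + 1` shows that the hyperplane is proper.
  have h2 : Pi.single ⟨0, hn⟩ (a + 1) ∈ (s : Set (Fin n → ℝ)) := by rw [h]; trivial
  rw [hs] at h2
  simp at h2

lemma ae_sum_ne {n : ℕ} (hn : 1 ≤ n) (a : ℝ) : ∀ᵐ y ∂(cubeUniform n), ∑ j, y j ≠ a := by
  have h : cubeUniform n ≪ volume := by
    rw [cubeUniform, ← Measure.restrict_pi_pi]
    exact Measure.restrict_le_self.absolutelyContinuous
  exact h.ae_le (ae_iff.2 (by simpa using volume_sum_eq hn a))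

/-- The indicator jumps only where `∑ y_j` is `x` or `x - 1`, a null set once `n ≥ 1`. Continuity is
what makes Fourier inversion valid at every point. -/
lemma continuous_sectionVolume {n : ℕ} (hn : 1 ≤ n) : Continuous (sectionVolume n) := by
  have hi : Measurable ((Icc (0 : ℝ) 1).indicator (1 : ℝ → ℝ)) :=
    measurable_one.indicator measurableSet_Icc
  refine continuous_iff_continuousAt.2 fun x ↦ continuousAt_of_dominated (bound := fun _ ↦ 1)
    (.of_forall fun x ↦ ?_) (.of_forall fun x ↦ .of_forall fun y ↦ ?_) (integrable_const _) ?_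
  · exact (hi.comp (by fun_prop)).aestronglyMeasurable
  · exact (norm_indicator_le_norm_self _ _).trans (by simp)
  · filter_upwards [ae_sum_ne hn x, ae_sum_ne hn (x - 1)] with y h0 h1
    have hc : ContinuousAt ((Icc (0 : ℝ) 1).indicator (1 : ℝ → ℝ)) (x - ∑ j, y j) := by
      refine ContinuousOn.continuousAt_indicator (f := fun _ ↦ (1 : ℝ)) continuousOn_const ?_
      rw [frontier_Icc zero_le_one]
      rintro (h | h)
      · exact h0 (by linarith)
      · rw [mem_singleton_iff] at h
        exact h1 (by linarith)
    exact hc.comp (f := fun x ↦ x - ∑ j, y j) (by fun_prop)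

open FourierTransform in
lemma fourier_exp_mul_sectionVolume (n : ℕ) (t v : ℝ) :
    𝓕 (fun x : ℝ ↦ Complex.exp (t * x) * sectionVolume n x) v =
      complexMGF id unitUniform (t + (-(2 * Real.pi) * v : ℝ) * Complex.I) ^ (n + 1) := by
  rw [Real.fourier_real_eq_integral_exp_smul, ← integral_exp_mul_sectionVolume]
  congr with x
  rw [smul_eq_mul, ← mul_assoc, ← Complex.exp_add]
  push_cast
  ring_nf

/-- The characteristic function of the centered and normalized tilted uniform distribution. -/
noncomputable def normalizedCharFun (t : ℝ) : ℝ → ℂ :=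
  charFun ((tiltedUniform t).map fun x ↦ (√(tiltedVar t))⁻¹ * (x - tiltedMean t))

lemma normalizedCharFun_mul_sqrt (t s : ℝ) : normalizedCharFun t (√(tiltedVar t) * s) =
    Complex.exp (-(s * tiltedMean t) * Complex.I) * charFun (tiltedUniform t) s := by
  have hv := Real.sqrt_pos.2 (tiltedVar_pos t)
  rw [normalizedCharFun, charFun_apply_real, charFun_apply_real,
    integral_map (by fun_prop) (by fun_prop), ← integral_const_mul]
  congr with x
  rw [← Complex.exp_add]
  have : ((√(tiltedVar t) : ℝ) : ℂ) ≠ 0 := by exact_mod_cast hv.ne'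
  congr 1
  push_cast
  field_simp
  ring

lemma normalizedCharFun_apply (t s : ℝ) : normalizedCharFun t s =
    Complex.exp (-(((√(tiltedVar t))⁻¹ * s : ℝ) * tiltedMean t) * Complex.I) *
      charFun (tiltedUniform t) ((√(tiltedVar t))⁻¹ * s) := by
  rw [← normalizedCharFun_mul_sqrt,
    mul_inv_cancel_left₀ (Real.sqrt_pos.2 (tiltedVar_pos t)).ne']

lemma exists_normSq_normalizedCharFun_mul_le (t : ℝ) : ∃ c > 0, ∀ s : ℝ,
    ‖normalizedCharFun t s‖ ^ 2 * (1 + c * s ^ 2) ≤ 1 := by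
  obtain ⟨c, hc, h⟩ := exists_normSq_charFun_mul_le t
  have hv := tiltedVar_pos t
  refine ⟨c * (tiltedVar t)⁻¹, by positivity, fun s ↦ ?_⟩
  have h1 := h ((√(tiltedVar t))⁻¹ * s)
  rw [mul_pow, inv_pow, Real.sq_sqrt hv.le, ← mul_assoc] at h1
  rw [normalizedCharFun_apply, norm_mul, ← Complex.ofReal_mul, ← Complex.ofReal_neg,
    Complex.norm_exp_ofReal_mul_I, one_mul]
  exact h1

lemma continuous_normalizedCharFun (t : ℝ) : Continuous (normalizedCharFun t) := by
  have := Measure.isProbabilityMeasure_map (μ := tiltedUniform t)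
    (f := fun x ↦ (√(tiltedVar t))⁻¹ * (x - tiltedMean t)) (by fun_prop)
  exact continuous_charFun

lemma tendsto_integral_normalizedCharFun_pow (t : ℝ) :
    Tendsto (fun n : ℕ ↦ ∫ s : ℝ, normalizedCharFun t ((√n)⁻¹ * s) ^ n) atTop
      (𝓝 (√(2 * Real.pi) : ℝ)) := by
  obtain ⟨c, hc, h⟩ := exists_normSq_normalizedCharFun_mul_le t
  have hv := tiltedVar_pos t
  have hint : Integrable (fun x : ℝ ↦ x) (tiltedUniform t) :=
    (memLp_id_tiltedUniform t).integrable one_le_two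
  refine tendsto_integral_charFun_pow (by fun_prop) ?_ ?_ hc h
  · rw [integral_const_mul, integral_sub hint (integrable_const _), integral_tiltedUniform]
    simp
  · have h1 := variance_tiltedUniform t
    rw [variance_eq_integral aemeasurable_id] at h1
    simp only [id, integral_tiltedUniform] at h1
    simp only [Pi.pow_apply, mul_pow]
    rw [integral_const_mul, h1, inv_pow, Real.sq_sqrt hv.le, inv_mul_cancel₀ hv.ne']

lemma complexMGF_eq_mul_charFun (t s : ℝ) :
    complexMGF id unitUniform (t + s * Complex.I) =
      mgf id unitUniform t * charFun (tiltedUniform t) s := by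
  rw [charFun_tiltedUniform, mul_div_cancel₀]
  exact_mod_cast (mgf_unitUniform_pos t).ne'

-- Fourier inversion for the weighted density at `x = N * tiltedMean t`. At this point the
-- oscillating factor of the inversion formula cancels the phase produced by centering the `N`
-- variables.
open FourierTransform in
lemma exp_mul_slabVolume {N : ℕ} (hN : 2 ≤ N) (t : ℝ) :
    Complex.exp (t * (tiltedMean t * N : ℝ)) * slabVolume N (tiltedMean t) =
      mgf id unitUniform t ^ N * ((2 * Real.pi * √(tiltedVar t))⁻¹ *
        ∫ s, normalizedCharFun t s ^ N : ℂ) := by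
  obtain ⟨n, rfl⟩ : ∃ n, N = n + 1 := ⟨N - 1, by omega⟩
  have hn : 1 ≤ n := by omega
  have hσ := Real.sqrt_pos.2 (tiltedVar_pos t)
  set x : ℝ := tiltedMean t * (n + 1 : ℕ) with hx
  -- The factor from the frequency `v` of `𝓕` to the argument of the normalized characteristic
  -- function; `|k⁻¹|` is the Jacobian.
  set k : ℝ := -(2 * Real.pi) * √(tiltedVar t) with hk
  have hk0 : k ≠ 0 := by
    have := Real.pi_pos
    rw [hk]
    exact (mul_neg_of_neg_of_pos (by linarith) hσ).ne
  have hF (v : ℝ) : 𝓕 (fun x : ℝ ↦ Complex.exp (t * x) * sectionVolume n x) v =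
      mgf id unitUniform t ^ (n + 1) *
        (Complex.exp ((-(2 * Real.pi * v * x) : ℝ) * Complex.I) *
          normalizedCharFun t (v * k) ^ (n + 1)) := by
    rw [fourier_exp_mul_sectionVolume, complexMGF_eq_mul_charFun, mul_pow]
    congr 1
    rw [show v * k = √(tiltedVar t) * (-(2 * Real.pi) * v) by rw [hk]; ring,
      normalizedCharFun_mul_sqrt, mul_pow, ← mul_assoc, ← Complex.exp_nat_mul, ← Complex.exp_add]
    have : (((-(2 * Real.pi * v * x) : ℝ) : ℂ) * Complex.I + (n + 1 : ℕ) *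
        (-((-(2 * Real.pi) * v : ℝ) * tiltedMean t) * Complex.I)) = 0 := by
      rw [hx]
      push_cast
      ring
    rw [this, Complex.exp_zero, one_mul]
  obtain ⟨c, hc, hb⟩ := exists_normSq_normalizedCharFun_mul_le t
  have hint : Integrable fun v : ℝ ↦ normalizedCharFun t (v * k) ^ (n + 1) :=
    (integrable_pow_of_normSq_mul_le (continuous_normalizedCharFun t) hc hb hN).comp_mul_right' hk0
  have hFint : Integrable (𝓕 fun x : ℝ ↦ Complex.exp (t * x) * sectionVolume n x) := by
    rw [show (𝓕 fun x : ℝ ↦ Complex.exp (t * x) * sectionVolume n x) = _ from funext hF]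
    refine Integrable.const_mul (hint.bdd_mul (c := 1) (by fun_prop) (.of_forall fun v ↦ ?_)) _
    rw [Complex.norm_exp_ofReal_mul_I]
  have hcont : Continuous fun x : ℝ ↦ Complex.exp (t * x) * sectionVolume n x :=
    (by fun_prop : Continuous fun x : ℝ ↦ Complex.exp (t * x)).mul
      (Complex.continuous_ofReal.comp (continuous_sectionVolume hn))
  have hinv := congrFun
    (hcont.fourierInv_fourier_eq (integrable_exp_mul_sectionVolume n t) hFint) x
  rw [slabVolume_eq_sectionVolume, Nat.add_sub_cancel, ← hx, ← hinv, Real.fourierInv_eq']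
  have hpt (v : ℝ) : Complex.exp ((2 * Real.pi * inner ℝ v x : ℝ) * Complex.I) •
      𝓕 (fun x : ℝ ↦ Complex.exp (t * x) * sectionVolume n x) v =
        mgf id unitUniform t ^ (n + 1) * normalizedCharFun t (v * k) ^ (n + 1) := by
    rw [hF, smul_eq_mul, mul_left_comm, ← mul_assoc (Complex.exp _), ← Complex.exp_add,
      show (2 * Real.pi * inner ℝ v x : ℝ) = 2 * Real.pi * v * x by simp; ring,
      Complex.ofReal_neg, neg_mul, add_neg_cancel, Complex.exp_zero, one_mul]
  simp_rw [hpt]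
  rw [integral_const_mul, Measure.integral_comp_mul_right (fun s ↦ normalizedCharFun t s ^ (n + 1))]
  congr 1
  have : |k⁻¹| = (2 * Real.pi * √(tiltedVar t))⁻¹ := by
    rw [abs_inv, hk, neg_mul, abs_neg, abs_of_pos (by positivity)]
  rw [this, Complex.real_smul]

/-- The slab volume in terms of the normalized characteristic function. -/
lemma slabVolume_tiltedMean {N : ℕ} (hN : 2 ≤ N) (t : ℝ) :
    (slabVolume N (tiltedMean t) : ℂ) =
      (slabRate t ^ N / (2 * Real.pi * √(tiltedVar t) * √N) : ℝ) *
        ∫ s : ℝ, normalizedCharFun t ((√N)⁻¹ * s) ^ N := by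
  have hσ := Real.sqrt_pos.2 (tiltedVar_pos t)
  have hN0 : (0 : ℝ) < N := by exact_mod_cast (by omega : 0 < N)
  have hsN := Real.sqrt_pos.2 hN0
  rw [Measure.integral_comp_mul_left (fun s ↦ normalizedCharFun t s ^ N), inv_inv,
    abs_of_pos hsN, Complex.real_smul]
  have h := exp_mul_slabVolume hN t
  have he : Complex.exp (t * (tiltedMean t * N : ℝ)) = (Real.exp (t * tiltedMean t) ^ N : ℝ) := by
    rw [← Real.exp_nat_mul]
    push_cast
    ring_nf
  have hr : slabRate t = mgf id unitUniform t / Real.exp (t * tiltedMean t) := by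
    rw [slabRate, Real.exp_sub, exp_uniformCgf]
  have he0 : ((Real.exp (t * tiltedMean t) ^ N : ℝ) : ℂ) ≠ 0 := by
    exact_mod_cast (pow_pos (Real.exp_pos _) N).ne'
  have hσ' : (√(tiltedVar t) : ℂ) ≠ 0 := by exact_mod_cast hσ.ne'
  have hsN' : (√(N : ℝ) : ℂ) ≠ 0 := by exact_mod_cast hsN.ne'
  have hpi : (Real.pi : ℂ) ≠ 0 := by exact_mod_cast Real.pi_pos.ne'
  rw [he] at h
  rw [← mul_right_inj' he0, h, hr]
  push_cast at he0 ⊢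
  rw [div_pow]
  field_simp

lemma isEquivalent_slabVolume (t : ℝ) :
    (fun N : ℕ ↦ slabVolume N (tiltedMean t)) ~[atTop]
      fun N : ℕ ↦ (√(2 * Real.pi * tiltedVar t))⁻¹ / √(N : ℝ) * slabRate t ^ N := by
  have hv := tiltedVar_pos t
  have hr := slabRate_pos t
  have hpi := Real.pi_pos
  refine (isEquivalent_iff_tendsto_one ?_).2 ?_
  · filter_upwards [eventually_ge_atTop 2] with N hN
    have hN0 : (0 : ℝ) < N := by exact_mod_cast (by omega : 0 < N)
    positivity
  · have h1 := ((Complex.continuous_re.tendsto _).comp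
      (tendsto_integral_normalizedCharFun_pow t)).div_const √(2 * Real.pi)
    rw [Complex.ofReal_re, div_self (by positivity)] at h1
    refine h1.congr' ?_
    filter_upwards [eventually_ge_atTop 2] with N hN
    have hN0 : (0 : ℝ) < N := by exact_mod_cast (by omega : 0 < N)
    have h2 := congrArg Complex.re (slabVolume_tiltedMean hN t)
    rw [Complex.ofReal_re, Complex.re_ofReal_mul] at h2
    have h3 : √(2 * Real.pi) ^ 2 = 2 * Real.pi := Real.sq_sqrt (by positivity)
    rw [Pi.div_apply, h2, Real.sqrt_mul (by positivity : (0 : ℝ) ≤ 2 * Real.pi),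
      Function.comp_apply]
    field_simp
    rw [h3]
    ring

/-! ### The asymptotic formula and its uniqueness -/

lemma slabVolume_eq_zero {N : ℕ} (hN : 2 ≤ N) {b a : ℝ} (h : ∀ y ∈ slab N b, ∑ j, y j = a) :
    slabVolume N b = 0 := by
  rw [slabVolume, measure_mono_null h (volume_sum_eq (by omega) a), ENNReal.toReal_zero]

lemma slabVolume_zero {N : ℕ} (hN : 2 ≤ N) : slabVolume N 0 = 0 :=
  slabVolume_eq_zero (a := 0) hN fun y hy ↦
    le_antisymm (by simpa using hy.2.2) (Finset.sum_nonneg fun j _ ↦ (hy.1 j).1)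

lemma slabVolume_one {N : ℕ} (hN : 2 ≤ N) : slabVolume N 1 = 0 := by
  refine slabVolume_eq_zero (a := N - 1) hN fun y hy ↦ le_antisymm ?_ (by simpa using hy.2.1)
  refine (Finset.sum_le_sum fun j _ ↦ (hy.1 j).2).trans ?_
  simp [Nat.cast_sub (by omega : 1 ≤ N)]

lemma hasSlabAsymptotics_slabConst_slabBase : HasSlabAsymptotics slabConst slabBase := by
  intro b hb
  have hend (h0 : slabBase b = 0) (h : ∀ N : ℕ, 2 ≤ N → slabVolume N b = 0) :
      (fun N : ℕ ↦ slabVolume N b) ~[atTop] fun N : ℕ ↦ slabConst b / √(N : ℝ) * slabBase b ^ N := by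
    refine EventuallyEq.isEquivalent ?_
    -- For `N = 1` the slab is a point of volume `1`; from `N = 2` on both sides vanish at the
    -- endpoints.
    filter_upwards [eventually_ge_atTop 2] with N hN
    rw [h N hN, h0, zero_pow (by omega), mul_zero]
  rcases eq_or_lt_of_le hb.1 with rfl | h0
  · exact hend slabBase_zero fun N hN ↦ slabVolume_zero hN
  rcases eq_or_lt_of_le hb.2 with rfl | h1
  · exact hend slabBase_one fun N hN ↦ slabVolume_one hN
  · have h := isEquivalent_slabVolume (tiltOf b)
    rwa [← slabBase_tiltedMean, tiltedMean_tiltOf ⟨h0, h1⟩] at h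

/-- If `(q ^ n)` converges to a nonzero limit then `q = 1`. -/
lemma eq_one_of_tendsto_pow {q l : ℝ} (hl : l ≠ 0) (h : Tendsto (fun n : ℕ ↦ q ^ n) atTop (𝓝 l)) :
    q = 1 := by
  have h1 : Tendsto (fun n : ℕ ↦ q ^ (n + 1)) atTop (𝓝 l) := h.comp (tendsto_add_atTop_nat 1)
  have h2 : Tendsto (fun n : ℕ ↦ q ^ (n + 1)) atTop (𝓝 (l * q)) := by
    simpa only [pow_succ] using h.mul_const q
  exact mul_left_cancel₀ hl (by rw [mul_one]; exact tendsto_nhds_unique h2 h1)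

/-- The quotient of the two sequences is `(a' / a) (q' / q) ^ N`. Its convergence to `1` forces
first `q' / q = 1`, with no sign condition on `q'`, and then `a' = a`. -/
lemma eq_of_isEquivalent_geometric {a a' q q' : ℝ} (ha : 0 < a) (ha' : 0 < a') (hq : 0 < q)
    (h : (fun N : ℕ ↦ a' / √(N : ℝ) * q' ^ N) ~[atTop] fun N : ℕ ↦ a / √(N : ℝ) * q ^ N) :
    a' = a ∧ q' = q := by
  have h1 : Tendsto (fun N : ℕ ↦ a' / a * (q' / q) ^ N) atTop (𝓝 1) := by
    have hne : ∀ᶠ N : ℕ in atTop, a / √(N : ℝ) * q ^ N ≠ 0 := by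
      filter_upwards [eventually_gt_atTop 0] with N hN
      have hN0 : (0 : ℝ) < N := by exact_mod_cast hN
      positivity
    refine ((isEquivalent_iff_tendsto_one hne).1 h).congr' ?_
    filter_upwards [eventually_gt_atTop 0] with N hN
    have hN0 : (0 : ℝ) < N := by exact_mod_cast hN
    rw [Pi.div_apply, div_pow]
    field_simp
  have h2 : Tendsto (fun N : ℕ ↦ (q' / q) ^ N) atTop (𝓝 ((a' / a)⁻¹ * 1)) := by
    refine (h1.const_mul (a' / a)⁻¹).congr fun N ↦ ?_
    rw [inv_mul_cancel_left₀ (by positivity)]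
  have hq1 : q' / q = 1 := eq_one_of_tendsto_pow (by positivity) h2
  simp only [hq1, one_pow, mul_one] at h1
  exact ⟨(div_eq_one_iff_eq ha.ne').1 (tendsto_nhds_unique tendsto_const_nhds h1),
    (div_eq_one_iff_eq hq.ne').1 hq1⟩

/-- Being equivalent to zero means being eventually zero, so positivity of `A b` forces `f b = 0`.
The value `A b` stays undetermined, which is why uniqueness of `A` is confined to the open interval.
-/
lemma HasSlabAsymptotics.eq_zero {A f : ℝ → ℝ} (h : HasSlabAsymptotics A f) {b : ℝ}
    (hb : b ∈ Icc 0 1) (hA : 0 < A b) (h0 : ∀ N : ℕ, 2 ≤ N → slabVolume N b = 0) : f b = 0 := by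
  have h1 : (fun N : ℕ ↦ A b / √(N : ℝ) * f b ^ N) ~[atTop] (0 : ℕ → ℝ) := by
    refine (h b hb).symm.trans (EventuallyEq.isEquivalent ?_)
    filter_upwards [eventually_ge_atTop 2] with N hN using h0 N hN
  obtain ⟨N, hN, hN1⟩ := ((isEquivalent_zero_iff_eventually_zero.1 h1).and
    (eventually_gt_atTop 0)).exists
  have hN0 : (0 : ℝ) < N := by exact_mod_cast hN1
  rcases mul_eq_zero.1 hN with h2 | h2
  · exact absurd h2 (by positivity)
  · exact eq_zero_of_pow_eq_zero h2

lemma HasSlabAsymptotics.eqOn {A f : ℝ → ℝ} (hA : ∀ β ∈ Icc (0 : ℝ) 1, 0 < A β)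
    (h : HasSlabAsymptotics A f) :
    EqOn A slabConst (Ioo 0 1) ∧ EqOn f slabBase (Icc 0 1) := by
  have hI {b : ℝ} (hb : b ∈ Ioo 0 1) : A b = slabConst b ∧ f b = slabBase b := by
    have hb' := Ioo_subset_Icc_self hb
    exact eq_of_isEquivalent_geometric (slabConst_pos b) (hA b hb') (slabBase_pos hb)
      ((h b hb').symm.trans (hasSlabAsymptotics_slabConst_slabBase b hb'))
  refine ⟨fun b hb ↦ (hI hb).1, fun b hb ↦ ?_⟩
  rcases eq_or_lt_of_le hb.1 with rfl | h0
  · rw [slabBase_zero, h.eq_zero hb (hA _ hb) fun N hN ↦ slabVolume_zero hN]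
  rcases eq_or_lt_of_le hb.2 with rfl | h1
  · rw [slabBase_one, h.eq_zero hb (hA _ hb) fun N hN ↦ slabVolume_one hN]
  · exact (hI ⟨h0, h1⟩).2

theorem theorem2p3 :
    -- the parameter map: continuous, strictly decreasing, onto `(0,1)`, with its limits
    (ContinuousOn betaParam (Ioi 0) ∧ StrictAntiOn betaParam (Ioi 0) ∧
      BijOn betaParam (Ioi 0) (Ioo 0 1) ∧
      Tendsto betaParam (𝓝[>] 0) (𝓝 1) ∧ Tendsto betaParam atTop (𝓝 0)) ∧
    -- the parametric expression for `f`: continuous, with its limits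
    (ContinuousOn fParam (Ioi 0) ∧
      Tendsto fParam (𝓝[>] 0) (𝓝 0) ∧ Tendsto fParam atTop (𝓝 0)) ∧
    -- the asymptotic formula and the identification of `f` and `A (1/2)`
    ∃ A f : ℝ → ℝ,
      (∀ β ∈ Icc (0 : ℝ) 1, 0 < A β) ∧ ContDiffOn ℝ 1 A (Ioo 0 1) ∧
      HasSlabAsymptotics A f ∧
      A (1 / 2) = √(6 / Real.pi) ∧
      (∀ z : ℝ, 0 < z → f (betaParam z) = fParam z) ∧
      ContinuousOn f (Icc 0 1) ∧ f 0 = 0 ∧ f 1 = 0 ∧ f (1 / 2) = 1 ∧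
      -- every pair with this asymptotic formula is the one just described
      ∀ A' f' : ℝ → ℝ, (∀ β ∈ Icc (0 : ℝ) 1, 0 < A' β) → HasSlabAsymptotics A' f' →
        EqOn A' A (Ioo 0 1) ∧ EqOn f' f (Icc 0 1) := by
  exact ⟨⟨continuousOn_betaParam, strictAntiOn_betaParam, bijOn_betaParam, tendsto_betaParam_zero,
      tendsto_betaParam_atTop⟩,
    ⟨continuousOn_fParam, tendsto_fParam_zero, tendsto_fParam_atTop⟩,
    slabConst, slabBase, fun b _ ↦ slabConst_pos b, contDiffOn_slabConst,
    hasSlabAsymptotics_slabConst_slabBase, slabConst_half, fun _ hz ↦ slabBase_betaParam hz,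
    continuousOn_slabBase, slabBase_zero, slabBase_one, slabBase_half,
    fun _ _ hA h ↦ h.eqOn hA⟩
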